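/- **Lemma (Contour properties).** Let $d\ge 2$, write $o$ for the origin of $\mathbb{Z}^d$, and for $m\in\mathbb{N}$ write $x\overset{m}{\sim}y$ if $\|x-y\|_1\le m$. A path $\pi:\mathbb{Z}_{\ge0}\to\mathbb{Z}^d$ is $m$-connected if $\pi(t)\overset{m}{\sim}\pi(t+1)$ for all $t$. A set $A\subset\mathbb{Z}^d$ is $m$-connected if for all $x,y\in A$ there is an $m$-connected path with values in $A$ that starts at $x$ and visits $y$; it is $m$-simply connected if both $A$ and $A^{\mathsf c}$ are $m$-connected. Let $\partial^mA=\{x\in A : \exists\, y\in A^{\mathsf c},\ x\overset{m}{\sim}y\}$ be the inner $m$-boundary of $A$, and let $\mathfrak{A}_m$ be the collection of all finite $m$-simply connected subsets of $\mathbb{Z}^d$ containing $o$. A point $x$ is $2$-enclosed by $A$ if every self-avoiding $2$-connected path $\pi:\mathbb{Z}_{\ge0}\to\mathbb{Z}^d$ with $\pi(0)=x$ meets $A$; let $\bar A$ be the set of all points that are $2$-enclosed by $A$. For finite $\Lambda\subset\mathbb{Z}^d$, $\lambda\in\mathbb{R}$ and $\omega\in\{-1,0,1\}^{\mathbb{Z}^d}$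 let $$H^{\mathbf 0,\lambda}_\Lambda(\omega)=-\lambda\sum_{x\in\Lambda}\omega_x^2+\infty\sum_{x\in\Lambda,\ y\in\mathbb{Z}^d:\ \|x-y\|_1=1}\mathbf 1\{\omega_x\omega_y=-1\}\qquad(\infty\cdot 0=0)$$ be the Widom--Rowlinson Hamiltonian with zero field, and let $\Omega^+_\Lambda$ be the set of all $\omega\in\{-1,0,1\}^{\mathbb{Z}^d}$ with $\omega_x=1$ for all $x\notin\Lambda$ and $H^{\mathbf 0,\lambda}_\Lambda(\omega)<\infty$. If $\omega_o\ne1$, let $B_\omega$ be the largest $1$-connected set containing $o$ on which $\omega_x\neq1$, and set $A_\omega=\bar B_\omega$; if $\omega_o=1$, set $A_\omega=\emptyset$. Then the following hold. 1. For every $\lambda\in\mathbb{R}$, every $\Lambda\in\mathfrak{A}_2$ and every $\omega\in\Omega^+_\Lambda$ with $\omega_o\neq1$, we have $A_\omega\in\mathfrak{A}_2$, and $\omega_x=0$ for all $x\in\partial^1A_\omega$. 2. There is a constant $C>0$, depending only on $d$, such that for all integers $n\ge0$ the set $\{A\in\mathfrak{A}_2 : |\partial^2A|=n\}$ is finite and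 $$\big|\{A\in\mathfrak{A}_2 : |\partial^2A|=n\}\big|\le C^n .$$ -/

import Mathlib

open scoped ENNReal

noncomputable section

namespace WidomRowlinson

/-- The hypercubic lattice `ℤ^d`. -/
abbrev Lattice (d : ℕ) : Type := Fin d → ℤ

/-- The `ℓ¹`-distance `‖x - y‖₁` on `ℤ^d`. -/
def l1Dist {d : ℕ} (x y : Lattice d) : ℤ := ∑ i, |x i - y i|

/-- `x` and `y` are nearest neighbours: `‖x - y‖₁ = 1`. -/
def Neighbor {d : ℕ} (x y : Lattice d) : Prop := l1Dist x y = 1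

/-- The relation `‖x - y‖₁ ≤ m`. -/
def Near {d : ℕ} (m : ℕ) (x y : Lattice d) : Prop := l1Dist x y ≤ (m : ℤ)

/-- An infinite path all of whose steps have `ℓ¹`-length at most `m` (zero steps are allowed). -/
def IsPath {d : ℕ} (m : ℕ) (p : ℕ → Lattice d) : Prop := ∀ t, Near m (p t) (p (t + 1))

/-- Any two points of `A` are visited by an `m`-connected path that stays in `A`. -/
def IsConn {d : ℕ} (m : ℕ) (A : Set (Lattice d)) : Prop :=
  ∀ x ∈ A, ∀ y ∈ A, ∃ p : ℕ → Lattice d,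
    IsPath m p ∧ (∀ t, p t ∈ A) ∧ p 0 = x ∧ ∃ t, p t = y

/-- `m`-simply connected sets: the set and its complement are both `m`-connected. -/
def IsSimplyConn {d : ℕ} (m : ℕ) (A : Set (Lattice d)) : Prop :=
  IsConn m A ∧ IsConn m Aᶜ

/-- `x` is `m`-enclosed by `A`: every self-avoiding infinite `m`-connected path from `x` meets
`A`. -/
def Enclosed {d : ℕ} (m : ℕ) (A : Set (Lattice d)) (x : Lattice d) : Prop :=
  ∀ p : ℕ → Lattice d, IsPath m p → Function.Injective p → p 0 = x → ∃ t, p t ∈ A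

/-- The inner `m`-boundary of `A`. -/
def innerBoundary {d : ℕ} (m : ℕ) (A : Set (Lattice d)) : Set (Lattice d) :=
  {x | x ∈ A ∧ ∃ y ∈ Aᶜ, Near m x y}

/-- The family of all finite `m`-simply connected subsets of `ℤ^d` that contain the origin. -/
def simpleSets (d m : ℕ) : Set (Set (Lattice d)) :=
  {A | IsSimplyConn m A ∧ A.Finite ∧ (0 : Lattice d) ∈ A}

/-- The `m`-closure of `A`: all points that are `m`-enclosed by `A`. -/
def encClosure {d : ℕ} (m : ℕ) (A : Set (Lattice d)) : Set (Lattice d) :=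
  {x | Enclosed m A x}

/-- Widom-Rowlinson configurations, with values in `{-1, 0, 1}`. -/
abbrev Config (d : ℕ) : Type := Lattice d → SignType

open Classical in
/-- The finite-volume Hamiltonian in `Λ`, with field `ζ` and parameter `lam`:
`-lam ∑_{x ∈ Λ} ω_x² + ∞ · ∑_{x ∈ Λ, y ∼ x} 1{ω_x ω_y = -1} - ∑_{x ∈ Λ} ζ_x ω_x`,
with the convention `∞ · 0 = 0`. -/
def hamiltonian {d : ℕ} (ζ : Lattice d → ℝ) (lam : ℝ) (Λ : Finset (Lattice d))
    (ω : Config d) : EReal :=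
  ((-lam * ∑ x ∈ Λ, ((ω x : SignType) : ℝ) ^ 2 : ℝ) : EReal)
    + (((⊤ : ℝ≥0∞) * ∑ x ∈ Λ, ∑' y : Lattice d,
        (if Neighbor x y ∧ ω x * ω y = -1 then (1 : ℝ≥0∞) else 0) : ℝ≥0∞) : EReal)
    - ((∑ x ∈ Λ, ζ x * ((ω x : SignType) : ℝ) : ℝ) : EReal)

/-- Configurations equal to `+1` off `Λ` whose energy in `Λ`, with zero field, is finite. -/
def plusConfigs {d : ℕ} (lam : ℝ) (Λ : Finset (Lattice d)) : Set (Config d) :=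
  {ω | (∀ x, x ∉ Λ → ω x = 1) ∧ hamiltonian (fun _ => 0) lam Λ ω < ⊤}

/-- The `1`-connected sets that contain the origin and on which `ω` is never `+1`. -/
def nonPlusSets {d : ℕ} (ω : Config d) : Set (Set (Lattice d)) :=
  {B | IsConn 1 B ∧ (0 : Lattice d) ∈ B ∧ ∀ x ∈ B, ω x ≠ 1}

/-- The largest member of `nonPlusSets ω` (if `ω` is not `+1` at the origin), see
`isGreatest_nonPlusCluster`. -/
def nonPlusCluster {d : ℕ} (ω : Config d) : Set (Lattice d) := ⋃₀ nonPlusSets ω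

/-- The contour set `A_ω`. -/
def contourSet {d : ℕ} (ω : Config d) : Set (Lattice d) :=
  if ω 0 = 1 then ∅ else encClosure 2 (nonPlusCluster ω)

theorem near_self {d : ℕ} (m : ℕ) (x : Lattice d) : Near m x x := by
  simp [Near, l1Dist]

theorem isGreatest_nonPlusCluster {d : ℕ} (ω : Config d) (h0 : ω 0 ≠ 1) :
    IsGreatest (nonPlusSets ω) (nonPlusCluster ω) := by
  refine ⟨⟨?_, ?_, ?_⟩, fun B hB => Set.subset_sUnion_of_mem hB⟩
  · rintro x ⟨A, hA, hx⟩ y ⟨B, hB, hy⟩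
    obtain ⟨p, hp, hpA, hp0, s, hs⟩ := hA.1 x hx 0 hA.2.1
    obtain ⟨q, hq, hqB, hq0, r, hr⟩ := hB.1 0 hB.2.1 y hy
    refine ⟨fun t => if t ≤ s then p t else q (t - s), ?_, ?_, ?_, s + r, ?_⟩
    · intro t
      rcases lt_trichotomy t s with h | h | h
      · simpa [h.le, Nat.succ_le_of_lt h] using hp t
      · subst h
        have := hq 0
        simp only [le_refl, if_true, Nat.not_succ_le_self, if_false, Nat.add_sub_cancel_left]
        rw [hs, ← hq0]
        exact this
      · have h1 : ¬ t ≤ s := by omega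
        have h2 : ¬ t + 1 ≤ s := by omega
        have h3 : t + 1 - s = t - s + 1 := by omega
        simpa [h1, h2, h3] using hq (t - s)
    · intro t
      by_cases h : t ≤ s
      · simpa [h, nonPlusCluster] using Set.mem_sUnion_of_mem (hpA t) hA
      · simpa [h, nonPlusCluster] using Set.mem_sUnion_of_mem (hqB (t - s)) hB
    · simpa using hp0
    · by_cases h : r = 0
      · subst h
        simp [hs, ← hr, hq0]
      · simp [h, hr]
  · refine ⟨{0}, ⟨?_, rfl, ?_⟩, rfl⟩
    · rintro x rfl y rfl
      exact ⟨fun _ => 0, fun _ => near_self 1 0, fun _ => rfl, rfl, 0, rfl⟩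
    · rintro x rfl
      exact h0
  · rintro x ⟨B, hB, hx⟩
    exact hB.2.2 x hx

end WidomRowlinson

end

/-! The count encodes `A` by its inner 2-boundary. This loses nothing (`injOn_innerBoundary`), and
the boundary is 2-connected (`isConn_innerBoundary`), hence traced by a walk of `2 * (n - 1)` steps
that starts at one of `n` points of a coordinate axis. Connectedness of the boundary is the
topological core. For a 2-component `S` of it, let a mod 2 cochain mark the edges joining `S` to the
complement of `A`. It is closed on small triangles, so it has a potential (`exists_potential`),
constant on `A` and on its complement. Thus all edges leaving `A` carry the same value, and `S` is
the whole boundary. For contours, enclosing a finite connected set fills its holes, and inner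
boundary points of the closure lie in the original set. There the cluster excludes `+1`, and the
hard-core constraint against a `+1` outer neighbour excludes `-1`. -/

namespace WidomRowlinson

variable {d : ℕ}

/-! ### Lattice geometry and unit steps. -/

theorem l1Dist_comm (x y : Lattice d) : l1Dist x y = l1Dist y x := by
  simp [l1Dist, abs_sub_comm]

theorem l1Dist_eq_zero {x y : Lattice d} : l1Dist x y = 0 ↔ x = y := by
  rw [l1Dist, Finset.sum_eq_zero_iff_of_nonneg fun i _ => abs_nonneg _, funext_iff]
  simp [sub_eq_zero]

theorem l1Dist_nonneg (x y : Lattice d) : 0 ≤ l1Dist x y :=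
  Finset.sum_nonneg fun _ _ => abs_nonneg _

theorem l1Dist_add_single (x : Lattice d) (i : Fin d) (a : ℤ) :
    l1Dist x (x + Pi.single i a) = |a| := by
  simp [l1Dist, Pi.single_apply, apply_ite abs]

theorem Near.symm {m : ℕ} {x y : Lattice d} (h : Near m x y) : Near m y x := by
  rwa [Near, l1Dist_comm]

theorem Near.mono {m n : ℕ} (hmn : m ≤ n) {x y : Lattice d} (h : Near m x y) : Near n x y :=
  le_trans h (by exact_mod_cast hmn)

theorem Near.trans {m n : ℕ} {x y z : Lattice d} (h : Near m x y) (h' : Near n y z) :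
    Near (m + n) x z := by
  have : l1Dist x z ≤ l1Dist x y + l1Dist y z := by
    unfold l1Dist
    rw [← Finset.sum_add_distrib]
    exact Finset.sum_le_sum fun i _ => abs_sub_le _ _ _
  unfold Near at *
  push_cast
  linarith

/-- `b` differs from `a` by plus or minus a unit vector. -/
def UnitStep (a b : Lattice d) : Prop :=
  ∃ i, b = a + Pi.single i 1 ∨ a = b + Pi.single i 1

theorem near_add_single (x : Lattice d) (i : Fin d) : Near 1 x (x + Pi.single i 1) := by
  simp [Near, l1Dist_add_single]

theorem UnitStep.near {a b : Lattice d} (h : UnitStep a b) : Near 1 a b := by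
  obtain ⟨i, rfl | rfl⟩ := h
  · exact near_add_single a i
  · exact (near_add_single b i).symm

theorem exists_unitStep_toward {x y : Lattice d} (h : x ≠ y) :
    ∃ z, UnitStep x z ∧ l1Dist z y = l1Dist x y - 1 ∧ ∀ i, x i = y i → z i = x i := by
  obtain ⟨i, hi⟩ := Function.ne_iff.1 h
  have key : ∀ s : ℤ, |x i + s - y i| = |x i - y i| - 1 →
      l1Dist (x + Pi.single i s) y = l1Dist x y - 1 ∧
        ∀ j, x j = y j → (x + Pi.single i s : Lattice d) j = x j := by
    intro s hs
    constructor
    · unfold l1Dist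
      rw [← Finset.add_sum_erase _ _ (Finset.mem_univ i),
        ← Finset.add_sum_erase _ (fun j => |x j - y j|) (Finset.mem_univ i)]
      have : ∑ j ∈ Finset.univ.erase i, |(x + Pi.single i s : Lattice d) j - y j|
          = ∑ j ∈ Finset.univ.erase i, |x j - y j| := by
        refine Finset.sum_congr rfl fun j hj => ?_
        simp [Finset.ne_of_mem_erase hj]
      rw [this]
      simp only [Pi.add_apply, Pi.single_eq_same]
      linarith
    · intro j hj
      have : j ≠ i := by rintro rfl; exact hi hj
      simp [this]
  rcases lt_or_gt_of_ne hi with hlt | hgt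
  · refine ⟨x + Pi.single i 1, ⟨i, Or.inl rfl⟩, key 1 ?_⟩
    rw [abs_of_nonpos (by omega), abs_of_neg (by omega)]
    ring
  · refine ⟨x + Pi.single i (-1), ⟨i, Or.inr ?_⟩, key (-1) ?_⟩
    · rw [add_assoc, ← Pi.single_add]
      simp
    · rw [abs_of_nonneg (by omega), abs_of_pos (by omega)]
      ring

/-- Keeping the common coordinates fixed later confines such walks to a hyperplane. -/
theorem reflTransGen_unitStep (x y : Lattice d) :
    Relation.ReflTransGen
      (fun a b => UnitStep a b ∧ ∀ i, x i = y i → b i = a i) x y := by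
  induction h : (l1Dist x y).toNat generalizing x with
  | zero =>
    have : x = y := l1Dist_eq_zero.1 (le_antisymm (Int.toNat_eq_zero.1 h) (l1Dist_nonneg _ _))
    rw [this]
  | succ n ih =>
    have hne : x ≠ y := by
      rintro rfl
      simp [l1Dist] at h
    obtain ⟨z, hz, hd, hc⟩ := exists_unitStep_toward hne
    refine Relation.ReflTransGen.head ⟨hz, hc⟩ (Relation.ReflTransGen.mono ?_ _ _ (ih z (by omega)))
    rintro a b ⟨hab, hab'⟩
    exact ⟨hab, fun i hi => hab' i ((hc i hi).trans hi)⟩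

theorem lattice_induction {P : Lattice d → Prop} (h0 : P 0)
    (hs : ∀ x i, P x ↔ P (x + Pi.single i 1)) (x : Lattice d) : P x := by
  have h : Relation.ReflTransGen UnitStep 0 x :=
    Relation.ReflTransGen.mono (fun _ _ h => h.1) _ _ (reflTransGen_unitStep 0 x)
  induction h with
  | refl => exact h0
  | tail _ h ih =>
    obtain ⟨i, rfl | rfl⟩ := h
    · exact (hs _ i).1 ih
    · exact (hs _ i).2 ih

/-- A `1`-cochain on `ℤ^d` that is closed on all triangles of diameter at most `2` is exact. -/
theorem exists_potential {G : Type*} [AddCommGroup G] (c : Lattice d → Lattice d → G)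
    (hc : ∀ x y z, Near 2 x y → Near 2 y z → Near 2 x z → c x y + c y z = c x z) :
    ∃ f : Lattice d → G, ∀ x y, Near 2 x y → f y = f x + c x y := by
  have hself : ∀ x, c x x = 0 := fun x => by
    simpa using hc x x x (near_self 2 x) (near_self 2 x) (near_self 2 x)
  -- Lift unit translations to `Lattice d × G`, accumulating `c`. The lifts commute because a
  -- diagonal cuts each unit square into two closed triangles, so they define an action of `ℤ^d`;
  -- the orbit of `(0, 0)` is the graph of the potential.
  let T : Fin d → Equiv.Perm (Lattice d × G) := fun i =>
    { toFun := fun p => (p.1 + Pi.single i 1, p.2 + c p.1 (p.1 + Pi.single i 1))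
      invFun := fun p => (p.1 - Pi.single i 1, p.2 - c (p.1 - Pi.single i 1) p.1)
      left_inv := fun p => by simp
      right_inv := fun p => by simp }
  have hT : ∀ i p, T i p = (p.1 + Pi.single i 1, p.2 + c p.1 (p.1 + Pi.single i 1)) :=
    fun _ _ => rfl
  have hcomm : ∀ i j, Commute (T i) (T j) := by
    intro i j
    refine Equiv.ext fun p => ?_
    have hsq : ∀ i j : Fin d, c p.1 (p.1 + Pi.single i 1) +
        c (p.1 + Pi.single i 1) (p.1 + Pi.single i 1 + Pi.single j 1)
        = c p.1 (p.1 + Pi.single i 1 + Pi.single j 1) := fun i j =>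
      hc _ _ _ ((near_add_single _ _).mono one_le_two) ((near_add_single _ _).mono one_le_two)
        ((near_add_single _ _).trans (near_add_single _ _))
    simp only [Equiv.Perm.mul_apply, hT, Prod.mk.injEq]
    rw [add_assoc p.2, add_assoc p.2, hsq, hsq, add_right_comm]
    exact ⟨rfl, rfl⟩
  let Φ : (Fin d → Multiplicative ℤ) →* Equiv.Perm (Lattice d × G) :=
    MonoidHom.noncommPiCoprod (fun i => zpowersHom _ (T i))
      (fun i j _ x y => by
      simpa using (hcomm i j).zpow_zpow x.toAdd y.toAdd)
  let F : Lattice d → Lattice d × G := fun x => Φ (fun i => Multiplicative.ofAdd (x i)) (0, 0)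
  have hF : ∀ x i, F (x + Pi.single i 1) = T i (F x) := by
    intro x i
    have h1 : (fun j => Multiplicative.ofAdd ((x + Pi.single i 1 : Lattice d) j))
        = Pi.mulSingle i (Multiplicative.ofAdd 1) * fun j => Multiplicative.ofAdd (x j) := by
      funext j
      by_cases h : j = i
      · subst h
        simp [ofAdd_add, mul_comm]
      · simp [h]
    have h2 : Φ (Pi.mulSingle i (Multiplicative.ofAdd 1)) = T i := by
      refine (MonoidHom.noncommPiCoprod_mulSingle _ i _).trans ?_
      simp
    simp only [F]
    rw [h1, map_mul, h2, Equiv.Perm.mul_apply]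
  have hF1 : ∀ x, (F x).1 = x := by
    refine lattice_induction ?_ fun x i => ?_
    · have : (fun i => Multiplicative.ofAdd ((0 : Lattice d) i)) = 1 := rfl
      simp only [F]
      rw [this, map_one, Equiv.Perm.one_apply]
    · rw [hF, hT]
      simp
  have hstep : ∀ x i, (F (x + Pi.single i 1)).2 = (F x).2 + c x (x + Pi.single i 1) := by
    intro x i
    rw [hF, hT, hF1]
  have hunit : ∀ x y, UnitStep x y → (F y).2 = (F x).2 + c x y := by
    rintro x y h
    have hn := h.near.mono one_le_two
    have hanti := hc x y x hn hn.symm (near_self 2 x)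
    rw [hself] at hanti
    obtain ⟨i, rfl | rfl⟩ := h
    · exact hstep _ _
    · rw [hstep, add_assoc, add_comm (c _ _), hanti, add_zero]
  refine ⟨fun x => (F x).2, fun x y hxy => ?_⟩
  by_cases h : x = y
  · subst h
    simp [hself]
  obtain ⟨z, hxz, hzy, -⟩ := exists_unitStep_toward h
  have hxy' : l1Dist x y ≤ 2 := by exact_mod_cast hxy
  by_cases h' : z = y
  · subst h'
    exact hunit _ _ hxz
  obtain ⟨w, hzw, hwy, -⟩ := exists_unitStep_toward h'
  have : w = y := l1Dist_eq_zero.1 (le_antisymm (by omega) (l1Dist_nonneg _ _))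
  subst this
  simp only
  rw [hunit _ _ hzw, hunit _ _ hxz, add_assoc,
    hc _ _ _ (hxz.near.mono one_le_two) (hzw.near.mono one_le_two) hxy]

/-! ### Connectedness and the inner boundary. -/

/-- Two points of `A` at `ℓ¹`-distance at most `m`. -/
def StepIn (m : ℕ) (A : Set (Lattice d)) (x y : Lattice d) : Prop :=
  Near m x y ∧ x ∈ A ∧ y ∈ A

theorem isConn_iff {m : ℕ} {A : Set (Lattice d)} :
    IsConn m A ↔ ∀ x ∈ A, ∀ y ∈ A, Relation.ReflTransGen (StepIn m A) x y := by
  refine ⟨fun h x hx y hy => ?_, fun h x hx y hy => ?_⟩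
  · obtain ⟨p, hp, hpA, rfl, t, rfl⟩ := h x hx y hy
    clear hx hy
    induction t with
    | zero => exact .refl
    | succ t ih => exact ih.tail ⟨hp t, hpA _, hpA _⟩
  · induction h x hx y hy using Relation.ReflTransGen.head_induction_on with
    | refl => exact ⟨fun _ => y, fun _ => near_self m y, fun _ => hy, rfl, 0, rfl⟩
    | @head a _ hac _ ih =>
      obtain ⟨p, hp, hpA, hp0, t, ht⟩ := ih hac.2.2
      refine ⟨fun t => Nat.casesOn t a p, ?_, ?_, rfl, t + 1, ht⟩
      · rintro (_ | t)
        · simpa [hp0] using hac.1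
        · exact hp t
      · rintro (_ | t)
        · exact hac.2.1
        · exact hpA t

theorem StepIn.symm {m : ℕ} {A : Set (Lattice d)} {x y : Lattice d} (h : StepIn m A x y) :
    StepIn m A y x :=
  ⟨h.1.symm, h.2.2, h.2.1⟩

theorem reflTransGen_stepIn_symm {m : ℕ} {A : Set (Lattice d)} {x y : Lattice d}
    (h : Relation.ReflTransGen (StepIn m A) x y) : Relation.ReflTransGen (StepIn m A) y x :=
  have : Std.Symm (StepIn m A) := ⟨fun _ _ => StepIn.symm⟩
  Relation.ReflTransGen.stdSymm.symm _ _ h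

theorem isConn_of_base {m : ℕ} {A : Set (Lattice d)} (b : Lattice d)
    (h : ∀ x ∈ A, Relation.ReflTransGen (StepIn m A) x b) : IsConn m A :=
  isConn_iff.2 fun x hx y hy => (h x hx).trans (reflTransGen_stepIn_symm (h y hy))

theorem eq_of_isConn {m : ℕ} {A : Set (Lattice d)} (hA : IsConn m A) {α : Type*}
    {f : Lattice d → α} (hf : ∀ x ∈ A, ∀ y ∈ A, Near m x y → f x = f y) {x y : Lattice d}
    (hx : x ∈ A) (hy : y ∈ A) : f x = f y := by
  induction isConn_iff.1 hA x hx y hy with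
  | refl => rfl
  | tail _ h ih => exact (ih h.2.1).trans (hf _ h.2.1 _ h.2.2 h.1)

/-- The inner `2`-boundary of a `2`-simply connected set is `2`-connected. -/
theorem isConn_innerBoundary {A : Set (Lattice d)} (hA : IsSimplyConn 2 A) :
    IsConn 2 (innerBoundary 2 A) := by
  classical
  refine isConn_iff.2 fun b hb b' hb' => ?_
  set S : Set (Lattice d) :=
    {x | Relation.ReflTransGen (StepIn 2 (innerBoundary 2 A)) b x} with hS
  let c : Lattice d → Lattice d → ZMod 2 := fun x y =>
    (if x ∈ A ∧ x ∈ S ∧ y ∉ A then 1 else 0) + (if y ∈ A ∧ y ∈ S ∧ x ∉ A then 1 else 0)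
  have hmem : ∀ x y z, Near 2 x y → Near 2 x z → Near 2 y z → x ∈ A → y ∈ A → z ∉ A →
      -- In a triangle with exactly two vertices in `A`, both are boundary points and 2-adjacent, so
      -- they share a component.
      (x ∈ S ↔ y ∈ S) := by
    intro x y z hxy hxz hyz hx hy hz
    have h : StepIn 2 (innerBoundary 2 A) x y := ⟨hxy, ⟨hx, z, hz, hxz⟩, ⟨hy, z, hz, hyz⟩⟩
    exact ⟨fun hxS => hxS.tail h, fun hyS => hyS.tail h.symm⟩
  have hc : ∀ x y z, Near 2 x y → Near 2 y z → Near 2 x z → c x y + c y z = c x z := by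
    intro x y z hxy hyz hxz
    have h1 := hmem x y z hxy hxz hyz
    have h2 := hmem y z x hyz hxy.symm hxz.symm
    have h3 := hmem x z y hxz hxy hyz.symm
    by_cases hx : x ∈ A <;> by_cases hy : y ∈ A <;> by_cases hz : z ∈ A <;>
      simp only [hx, hy, hz, not_true_eq_false, not_false_eq_true, forall_true_left,
        IsEmpty.forall_iff] at h1 h2 h3 <;>
      simp only [c, hx, hy, hz, not_true_eq_false, not_false_eq_true, true_and, false_and,
        and_true, and_false, if_false, add_zero, zero_add, CharTwo.add_self_eq_zero, h1, h2, h3]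
  obtain ⟨f, hf⟩ := exists_potential c hc
  have hin : ∀ x ∈ A, ∀ y ∈ A, f x = f y := fun x hx y hy =>
    eq_of_isConn hA.1 (fun u hu v hv huv => by simp [hf u v huv, c, hu, hv]) hx hy
  have hout : ∀ x ∈ Aᶜ, ∀ y ∈ Aᶜ, f x = f y := fun x hx y hy =>
    eq_of_isConn hA.2 (fun u hu v hv huv => by
      have hu' : u ∉ A := hu
      have hv' : v ∉ A := hv
      simp [hf u v huv, c, hu', hv']) hx hy
  obtain ⟨hbA, e, he, hbe⟩ := hb
  obtain ⟨hbA', e', he', hbe'⟩ := hb'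
  have h1 := hf b e hbe
  have h2 := hf b' e' hbe'
  -- The edges `b e` and `b' e'` have the same potential difference; if `b' ∉ S` the first is marked
  -- and the second is not.
  rw [hin b hbA b' hbA', hout e he e' he', h2] at h1
  have heA : e ∉ A := he
  have heA' : e' ∉ A := he'
  have hbS : b ∈ S := Relation.ReflTransGen.refl
  by_contra hcon
  have hbS' : b' ∉ S := hcon
  simp [c, hbA, hbA', heA, heA', hbS, hbS'] at h1

/-- A set whose complement is `2`-connected is determined by its inner `2`-boundary. -/
theorem subset_of_innerBoundary_eq {m : ℕ} {A A' : Set (Lattice d)} (hA : IsConn m Aᶜ)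
    (hB : innerBoundary m A' ⊆ innerBoundary m A) {p : Lattice d} (hp : p ∉ A) (hp' : p ∉ A') :
    A' ⊆ A := by
  intro y hy'
  by_contra hy
  suffices h : ∀ z, Relation.ReflTransGen (StepIn m Aᶜ) p z → z ∉ A' from
    h y (isConn_iff.1 hA p hp y hy) hy'
  intro z hz
  induction hz with
  | refl => exact hp'
  -- A walk in `Aᶜ` could enter `A'` only at a boundary point of `A'`, which lies in `A`.
  | tail _ h ih => exact fun hc => h.2.2 (hB ⟨hc, _, ih, h.1.symm⟩).1

theorem lattice_infinite (hd : 0 < d) : Infinite (Lattice d) :=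
  have : Nonempty (Fin d) := ⟨⟨0, hd⟩⟩
  inferInstance

theorem injOn_innerBoundary (hd : 0 < d) :
    Set.InjOn (innerBoundary 2) (simpleSets d 2) := by
  intro A hA A' hA' h
  have := lattice_infinite hd
  obtain ⟨p, hp⟩ := (hA.2.1.union hA'.2.1).infinite_compl.nonempty
  have hp1 : p ∉ A := fun h => hp (Or.inl h)
  have hp2 : p ∉ A' := fun h => hp (Or.inr h)
  exact (subset_of_innerBoundary_eq hA'.1.2 h.le hp2 hp1).antisymm
    (subset_of_innerBoundary_eq hA.1.2 h.ge hp1 hp2)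

/-! ### Counting sets through walks. -/

/-- A finite `m`-connected set is the range of a walk that visits at most twice as many points. -/
theorem exists_covering_walk {m : ℕ} {B : Set (Lattice d)} (hB : IsConn m B) (hfin : B.Finite)
    {v : Lattice d} (hv : v ∈ B) {n : ℕ} (hn : B.ncard = n + 1) :
    ∃ l : List (Lattice d), l.IsChain (Near m) ∧ l.head? = some v ∧ l.length = 2 * n + 1 ∧
      {x | x ∈ l} = B := by
  classical
  have grow : ∀ k, k ≤ n → ∃ l : List (Lattice d), l.IsChain (Near m) ∧ l.head? = some v ∧
      l.length = 2 * k + 1 ∧ (∀ x ∈ l, x ∈ B) ∧ l.toFinset.card = k + 1 := by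
    intro k
    induction k with
    | zero =>
      intro _
      exact ⟨[v], by simp, by simp, by simp, by simpa using hv, by simp⟩
    | succ k ih =>
      intro hk
      obtain ⟨l, hl, hhead, hlen, hlB, hcard⟩ := ih (by omega)
      obtain ⟨y, hyB, hyl⟩ : ∃ y ∈ B, y ∉ l := by
        by_contra! hcon
        have : B ⊆ (l.toFinset : Set (Lattice d)) := fun z hz => by simpa using hcon z hz
        have := Set.ncard_le_ncard this (Finset.finite_toSet _)
        rw [Set.ncard_coe_finset] at this
        omega
      obtain ⟨s, u, hs, hu, huB, hsu⟩ : ∃ s u, s ∈ l ∧ u ∉ l ∧ u ∈ B ∧ Near m s u := by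
        by_contra! hcon
        suffices h : ∀ z, Relation.ReflTransGen (StepIn m B) v z → z ∈ l from
          hyl (h y (isConn_iff.1 hB v hv y hyB))
        intro z hz
        induction hz with
        | refl => exact List.mem_of_mem_head? hhead
        | tail _ h ih =>
          by_contra hc
          exact hcon _ _ ih hc h.2.2 h.1
      obtain ⟨l₁, l₂, rfl⟩ := List.append_of_mem hs
      -- The detour `s, u, s` adds one new point at the cost of two entries.
      refine ⟨l₁ ++ s :: u :: s :: l₂, ?_, ?_, ?_, ?_, ?_⟩
      · rw [List.isChain_split] at hl ⊢
        exact ⟨hl.1, by simpa using ⟨hsu, hsu.symm, hl.2⟩⟩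
      · rcases l₁ with _ | ⟨a, l₁⟩ <;> simpa using hhead
      · simp only [List.length_append, List.length_cons] at hlen ⊢
        omega
      · intro x hx
        simp only [List.mem_append, List.mem_cons] at hx hlB
        rcases hx with hx | hx | hx | hx | hx
        · exact hlB x (Or.inl hx)
        · exact hlB x (Or.inr (Or.inl hx))
        · exact hx ▸ huB
        · exact hlB x (Or.inr (Or.inl hx))
        · exact hlB x (Or.inr (Or.inr hx))
      · have : (l₁ ++ s :: u :: s :: l₂).toFinset = insert u (l₁ ++ s :: l₂).toFinset := by
          ext z
          simp only [List.mem_toFinset, Finset.mem_insert, List.mem_append, List.mem_cons]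
          tauto
        rw [this, Finset.card_insert_of_notMem (by rwa [List.mem_toFinset]), hcard]
  obtain ⟨l, hl, hhead, hlen, hlB, hcard⟩ := grow n le_rfl
  refine ⟨l, hl, hhead, hlen, Set.eq_of_subset_of_ncard_le hlB ?_ hfin⟩
  have : {x | x ∈ l} = (l.toFinset : Set (Lattice d)) := by
    ext
    simp
  rw [this, Set.ncard_coe_finset, hcard, hn]

theorem abs_sub_le_l1Dist (x y : Lattice d) (i : Fin d) : |x i - y i| ≤ l1Dist x y :=
  Finset.single_le_sum (f := fun i => |x i - y i|) (fun _ _ => abs_nonneg _) (Finset.mem_univ i)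

/-- Each displacement lies in the cube `[-m, m]^d`, whose cardinality serves as `K`. -/
theorem exists_finset_walks (d m : ℕ) : ∃ K : ℕ, 0 < K ∧ ∀ (n : ℕ) (v : Lattice d),
    ∃ F : Finset (List (Lattice d)), F.card ≤ K ^ n ∧
      ∀ l : List (Lattice d), l.IsChain (Near m) → l.head? = some v → l.length = n + 1 →
        l ∈ F := by
  classical
  let N : Finset (Lattice d) := Finset.Icc (fun _ => -(m : ℤ)) (fun _ => (m : ℤ))
  refine ⟨N.card, Finset.card_pos.2 ⟨0, ?_⟩, fun n => ?_⟩
  · simp [N, Pi.le_def]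
  induction n with
  | zero =>
    refine fun v => ⟨{[v]}, by simp, fun l _ hv hl => ?_⟩
    obtain ⟨a, rfl⟩ := List.length_eq_one_iff.1 hl
    simpa using hv
  | succ n ih =>
    choose F hF hmem using ih
    refine fun v => ⟨N.biUnion fun z => (F (v + z)).image (List.cons v), ?_, ?_⟩
    · refine Finset.card_biUnion_le.trans ?_
      rw [pow_succ']
      exact Finset.sum_le_card_nsmul _ _ _ fun z _ => Finset.card_image_le.trans (hF _)
    · intro l hl hv hlen
      match l, hl, hv, hlen with
      | a :: b :: l, hl, hv, hlen =>
        obtain rfl : a = v := by simpa using hv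
        rw [List.isChain_cons_cons] at hl
        refine Finset.mem_biUnion.2 ⟨b - a, ?_, Finset.mem_image.2 ⟨b :: l, ?_, rfl⟩⟩
        · have h : ∀ i, |a i - b i| ≤ m := fun i => (abs_sub_le_l1Dist a b i).trans hl.1
          simp only [N, Finset.mem_Icc, Pi.le_def, Pi.sub_apply]
          exact ⟨fun i => by have := abs_le.1 (h i); omega,
            fun i => by have := abs_le.1 (h i); omega⟩
        · exact hmem _ _ hl.2 (by simp) (by simpa using hlen)

/-- The half-line from `x` in direction `s • eᵢ`. -/
def ray (s : ℤ) (x : Lattice d) (i : Fin d) (t : ℕ) : Lattice d := x + Pi.single i (s * t)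

theorem isPath_ray {s : ℤ} (hs : |s| = 1) {m : ℕ} (hm : 1 ≤ m) (x : Lattice d) (i : Fin d) :
    IsPath m (ray s x i) := by
  intro t
  have : ray s x i (t + 1) = ray s x i t + Pi.single i s := by
    unfold ray
    rw [add_assoc, ← Pi.single_add]
    push_cast
    ring_nf
  rw [this, Near, l1Dist_add_single, hs]
  exact_mod_cast hm

theorem ray_injective {s : ℤ} (hs : |s| = 1) (x : Lattice d) (i : Fin d) :
    Function.Injective (ray s x i) := by
  intro t t' h
  have h0 : s ≠ 0 := by rintro rfl; simp at hs
  simpa [ray, h0] using congrFun h i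

theorem ray_zero (s : ℤ) (x : Lattice d) (i : Fin d) : ray s x i 0 = x := by
  simp [ray]

/-- A half-line that starts in a finite set leaves it through the inner boundary. -/
theorem exists_ray_mem_innerBoundary {m : ℕ} (hm : 1 ≤ m) {A : Set (Lattice d)} (hA : A.Finite)
    {x : Lattice d} (hx : x ∈ A) (i : Fin d) :
    ∃ t, ray 1 x i t ∈ innerBoundary m A ∧ ∀ s ≤ t, ray 1 x i s ∈ A := by
  classical
  have hex : ∃ t, ray 1 x i t ∉ A := by
    by_contra! hcon
    exact Set.infinite_of_injective_forall_mem (ray_injective abs_one x i) hcon hA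
  obtain ⟨k, hk⟩ : ∃ k, Nat.find hex = k + 1 := by
    refine Nat.exists_eq_succ_of_ne_zero fun h0 => ?_
    have := Nat.find_spec hex
    rw [h0, ray_zero] at this
    exact this hx
  have hlt : ∀ s ≤ k, ray 1 x i s ∈ A := fun s hs => by
    simpa using Nat.find_min hex (m := s) (by omega)
  have hout := Nat.find_spec hex
  rw [hk] at hout
  exact ⟨k, ⟨hlt k le_rfl, _, hout, isPath_ray abs_one hm x i k⟩, hlt⟩

/-- If the ray in direction `i` exits at step `k`, the rays in direction `j` from its first `k + 1`
points hit the boundary at points with distinct `i`-th coordinates, so the boundary has more than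
`k` points. -/
theorem exists_axis_mem_innerBoundary {m : ℕ} (hm : 1 ≤ m) {A : Set (Lattice d)} (hA : A.Finite)
    {x : Lattice d} (hx : x ∈ A) {i j : Fin d} (hij : i ≠ j) :
    ∃ k < (innerBoundary m A).ncard, ray 1 x i k ∈ innerBoundary m A := by
  classical
  obtain ⟨k, hk, hle⟩ := exists_ray_mem_innerBoundary hm hA hx i
  refine ⟨k, ?_, hk⟩
  have h : ∀ s : Fin (k + 1), ∃ t, ray 1 (ray 1 x i s) j t ∈ innerBoundary m A := fun s =>
    (exists_ray_mem_innerBoundary hm hA (hle s (by omega)) j).imp fun _ h => h.1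
  choose t ht using h
  have hinj : Function.Injective fun s : Fin (k + 1) => ray 1 (ray 1 x i s) j (t s) := by
    intro s s' h
    have := congrFun h i
    simpa [ray, hij, Fin.ext_iff] using this
  have hfin : (innerBoundary m A).Finite := hA.subset fun _ h => h.1
  have hcard := Set.ncard_le_ncard (Set.range_subset_iff.2 ht) hfin
  rw [← Set.image_univ, Set.ncard_image_of_injective _ hinj, Set.ncard_univ, Nat.card_eq_fintype_card,
    Fintype.card_fin] at hcard
  omega

theorem exists_count_bound (hd : 2 ≤ d) : ∃ C : ℝ, 0 < C ∧ ∀ n : ℕ,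
    {A | A ∈ simpleSets d 2 ∧ (innerBoundary 2 A).encard = (n : ℕ∞)}.Finite ∧
    (({A | A ∈ simpleSets d 2 ∧ (innerBoundary 2 A).encard = (n : ℕ∞)}.ncard : ℕ) : ℝ)
      ≤ C ^ n := by
  classical
  obtain ⟨K, hK, hwalk⟩ := exists_finset_walks d 2
  choose F hF hmem using hwalk
  -- The factor `2 ^ n` absorbs the `n` starting points and `K ^ (2 * n)` the walks. For `n = 0`
  -- there is no starting point, so the truncated `n - 1` does no harm.
  refine ⟨2 * K ^ 2, by positivity, fun n => ?_⟩
  set T := {A | A ∈ simpleSets d 2 ∧ (innerBoundary 2 A).encard = (n : ℕ∞)} with hT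
  let i : Fin d := ⟨0, by omega⟩
  let j : Fin d := ⟨1, by omega⟩
  have hij : i ≠ j := by simp [i, j]
  have hinj : Set.InjOn (innerBoundary 2) T :=
    (injOn_innerBoundary (by omega)).mono fun _ h => h.1
  let G : Finset (Set (Lattice d)) := (Finset.range n).biUnion fun k =>
    (F (2 * (n - 1)) (ray 1 0 i k)).image fun l => {x | x ∈ l}
  have hG : innerBoundary 2 '' T ⊆ G := by
    rintro _ ⟨A, ⟨hA, hcard⟩, rfl⟩
    have hn : (innerBoundary 2 A).ncard = n := by simp [Set.ncard, hcard]
    obtain ⟨k, hk, hkB⟩ := exists_axis_mem_innerBoundary one_le_two hA.2.1 hA.2.2 hij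
    rw [hn] at hk
    obtain ⟨l, hl, hhead, hlen, hlB⟩ := exists_covering_walk (isConn_innerBoundary hA.1)
      (hA.2.1.subset fun _ h => h.1) hkB (n := n - 1) (by omega)
    simp only [G, Finset.mem_coe, Finset.mem_biUnion, Finset.mem_range, Finset.mem_image]
    exact ⟨k, hk, l, hmem _ _ l hl hhead hlen, hlB⟩
  have hGcard : G.card ≤ n * K ^ (2 * (n - 1)) := by
    refine Finset.card_biUnion_le.trans ?_
    refine (Finset.sum_le_card_nsmul _ _ _ fun k _ =>
      Finset.card_image_le.trans (hF _ _)).trans ?_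
    simp
  refine ⟨Set.Finite.of_finite_image (G.finite_toSet.subset hG) hinj, ?_⟩
  have hle : T.ncard ≤ (2 * K ^ 2) ^ n := by
    rw [← hinj.ncard_image]
    calc (innerBoundary 2 '' T).ncard ≤ (G : Set (Set (Lattice d))).ncard :=
          Set.ncard_le_ncard hG G.finite_toSet
      _ = G.card := Set.ncard_coe_finset G
      _ ≤ n * K ^ (2 * (n - 1)) := hGcard
      _ ≤ 2 ^ n * K ^ (2 * n) :=
          Nat.mul_le_mul Nat.lt_two_pow_self.le (Nat.pow_le_pow_right hK (by omega))
      _ = (2 * K ^ 2) ^ n := by rw [mul_pow, pow_mul]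
  exact_mod_cast hle

/-! ### The closure by enclosed points. -/

theorem subset_encClosure (m : ℕ) (B : Set (Lattice d)) : B ⊆ encClosure m B :=
  fun _ hx _ _ _ hp0 => ⟨0, by rwa [hp0]⟩

theorem notMem_encClosure_iff {m : ℕ} {B : Set (Lattice d)} {x : Lattice d} :
    x ∉ encClosure m B ↔
      ∃ p, IsPath m p ∧ Function.Injective p ∧ p 0 = x ∧ ∀ t, p t ∉ B := by
  simp [encClosure, Enclosed]

theorem path_notMem_encClosure {m : ℕ} {B : Set (Lattice d)} {p : ℕ → Lattice d}
    (hp : IsPath m p) (hinj : Function.Injective p) (hB : ∀ t, p t ∉ B) (t : ℕ) :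
    p t ∉ encClosure m B :=
  notMem_encClosure_iff.2 ⟨fun s => p (t + s), fun s => hp (t + s),
    fun _ _ h => by simpa using hinj h, rfl, fun s => hB (t + s)⟩

/-- The non-enclosed points are closed under steps that stay off the enclosing set. -/
theorem notMem_encClosure_of_near {m : ℕ} {B : Set (Lattice d)} {x y : Lattice d} (hx : x ∉ B)
    (hxy : Near m x y) (hy : y ∉ encClosure m B) : x ∉ encClosure m B := by
  obtain ⟨q, hq, hinj, rfl, hqB⟩ := notMem_encClosure_iff.1 hy
  -- To stay self-avoiding, use the tail of `q` from `x` if `q` visits `x`; otherwise prepend `x`.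
  by_cases h : ∃ t, q t = x
  · obtain ⟨t, rfl⟩ := h
    exact path_notMem_encClosure hq hinj hqB t
  · refine notMem_encClosure_iff.2 ⟨fun t => Nat.casesOn t x q, ?_, ?_, rfl, ?_⟩
    · rintro (_ | t)
      · exact hxy
      · exact hq t
    · rintro (_ | s) (_ | t) hst
      · rfl
      · exact (h ⟨t, hst.symm⟩).elim
      · exact (h ⟨s, hst⟩).elim
      · exact congrArg _ (hinj hst)
    · rintro (_ | t)
      · exact hx
      · exact hqB t

theorem innerBoundary_encClosure_subset (m : ℕ) (B : Set (Lattice d)) :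
    innerBoundary m (encClosure m B) ⊆ B := by
  rintro x ⟨hx, y, hy, hxy⟩
  by_contra hxB
  exact notMem_encClosure_of_near hxB hxy hy hx

/-- From a point outside the box, the ray pointing away from it along coordinate `i` never meets
`B`. -/
theorem abs_le_of_mem_encClosure {m : ℕ} (hm : 1 ≤ m) {B : Set (Lattice d)} {R : ℤ}
    (hR : ∀ z ∈ B, ∀ i, |z i| ≤ R) {x : Lattice d} (hx : x ∈ encClosure m B) (i : Fin d) :
    |x i| ≤ R := by
  by_contra! hcon
  obtain ⟨s, hs, hsx⟩ : ∃ s : ℤ, |s| = 1 ∧ |x i| = s * x i := by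
    rcases abs_cases (x i) with h | h
    · exact ⟨1, by simp, by linarith⟩
    · exact ⟨-1, by simp, by linarith⟩
  obtain ⟨t, ht⟩ := hx (ray s x i) (isPath_ray hs hm x i) (ray_injective hs x i) (ray_zero s x i)
  have h := hR _ ht i
  have hss : s * s = 1 := by rw [← abs_mul_abs_self, hs, one_mul]
  have h1 : s * (ray s x i t) i ≤ R := by
    refine (le_abs_self _).trans ?_
    rwa [abs_mul, hs, one_mul]
  have h2 : s * (ray s x i t) i = s * x i + t := by
    simp only [ray, Pi.add_apply, Pi.single_eq_same]
    rw [mul_add, ← mul_assoc, hss, one_mul]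
  have : (0 : ℤ) ≤ t := Int.natCast_nonneg t
  linarith

theorem exists_box_bound {B : Set (Lattice d)} (hB : B.Finite) :
    ∃ R : ℤ, ∀ z ∈ B, ∀ i, |z i| ≤ R := by
  obtain ⟨R, hR⟩ := (hB.image fun z => l1Dist z 0).bddAbove
  refine ⟨R, fun z hz i => ?_⟩
  have := (abs_sub_le_l1Dist z 0 i).trans (hR ⟨z, hz, rfl⟩)
  simpa using this

theorem finite_box (R : ℤ) : {z : Lattice d | ∀ i, |z i| ≤ R}.Finite := by
  refine (Set.finite_Icc (fun _ => -R : Lattice d) (fun _ => R)).subset fun z hz => ?_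
  exact ⟨fun i => (abs_le.1 (hz i)).1, fun i => (abs_le.1 (hz i)).2⟩

theorem encClosure_finite {m : ℕ} (hm : 1 ≤ m) {B : Set (Lattice d)} (hB : B.Finite) :
    (encClosure m B).Finite := by
  obtain ⟨R, hR⟩ := exists_box_bound hB
  exact (finite_box R).subset fun _ hx => abs_le_of_mem_encClosure hm hR hx

/-- Two points of a coordinate hyperplane are connected inside it. -/
theorem reflTransGen_stepIn_of_coord_eq {m : ℕ} (hm : 1 ≤ m) {S : Set (Lattice d)}
    {x y : Lattice d} {i : Fin d} (hxy : x i = y i) (hS : ∀ z : Lattice d, z i = x i → z ∈ S) :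
    Relation.ReflTransGen (StepIn m S) x y := by
  suffices h : ∀ z, Relation.ReflTransGen
      (fun a b => UnitStep a b ∧ ∀ i, x i = y i → b i = a i) x z →
      Relation.ReflTransGen (StepIn m S) x z ∧ z i = x i from
    (h y (reflTransGen_unitStep x y)).1
  intro z hz
  induction hz with
  | refl => exact ⟨.refl, rfl⟩
  | tail _ h ih =>
    have hi := (h.2 i hxy).trans ih.2
    exact ⟨ih.1.tail ⟨h.1.near.mono hm, hS _ ih.2, hS _ hi⟩, hi⟩

/-- A self-avoiding path avoiding `B` must leave the box. Outside it, two hyperplanes normal to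
different axes, both disjoint from the box, lead to the fixed corner `(R + 1, ..., R + 1)`. -/
theorem isConn_compl_encClosure {m : ℕ} (hm : 1 ≤ m) (hd : 2 ≤ d) {B : Set (Lattice d)}
    (hB : B.Finite) : IsConn m (encClosure m B)ᶜ := by
  obtain ⟨R, hR⟩ := exists_box_bound hB
  have hout : ∀ (z : Lattice d) (i : Fin d), R < |z i| → z ∈ (encClosure m B)ᶜ :=
    fun z i hi hz => not_lt.2 (abs_le_of_mem_encClosure hm hR hz i) hi
  have : Nontrivial (Fin d) := Fin.nontrivial_iff_two_le.2 hd
  refine isConn_of_base (fun _ => R + 1) fun x hx => ?_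
  obtain ⟨p, hp, hinj, rfl, hpB⟩ := notMem_encClosure_iff.1 hx
  have hpE := path_notMem_encClosure hp hinj hpB
  obtain ⟨t, ht⟩ : ∃ t, ∃ i, R < |p t i| := by
    by_contra! hcon
    exact Set.infinite_of_injective_forall_mem hinj
      (s := {z : Lattice d | ∀ i, |z i| ≤ R}) hcon
      (finite_box R)
  obtain ⟨i, hi⟩ := ht
  have h1 : ∀ s, Relation.ReflTransGen (StepIn m (encClosure m B)ᶜ) (p 0) (p s) := by
    intro s
    induction s with
    | zero => exact .refl
    | succ s ih => exact ih.tail ⟨hp s, hpE s, hpE (s + 1)⟩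
  obtain ⟨j, hj⟩ := exists_ne i
  refine (h1 t).trans (Relation.ReflTransGen.trans
    (b := Function.update (fun _ => R + 1) i (p t i)) ?_ ?_)
  · exact reflTransGen_stepIn_of_coord_eq hm (i := i) (by simp)
      fun z hz => hout z i (by rwa [hz])
  · refine reflTransGen_stepIn_of_coord_eq hm (i := j) (by simp [hj]) fun z hz => hout z j ?_
    rw [hz, Function.update_of_ne hj]
    exact (lt_add_one R).trans_le (le_abs_self _)

/-- A ray from an enclosed point stays enclosed until it first hits `B`, which is itself connected.
-/
theorem isConn_encClosure {m : ℕ} (hm : 1 ≤ m) (hd : 0 < d) {B : Set (Lattice d)}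
    (hB : IsConn m B) {b : Lattice d} (hb : b ∈ B) : IsConn m (encClosure m B) := by
  classical
  refine isConn_of_base b fun x hx => ?_
  let i : Fin d := ⟨0, hd⟩
  have hpath := isPath_ray abs_one hm x i
  have hex := hx _ hpath (ray_injective abs_one x i) (ray_zero 1 x i)
  have hlt : ∀ s < Nat.find hex, ray 1 x i s ∉ B := fun s hs => Nat.find_min hex hs
  have hreach : ∀ s ≤ Nat.find hex, ray 1 x i s ∈ encClosure m B ∧
      Relation.ReflTransGen (StepIn m (encClosure m B)) x (ray 1 x i s) := by
    intro s
    induction s with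
    | zero =>
      intro _
      rw [ray_zero]
      exact ⟨hx, .refl⟩
    | succ s ih =>
      intro hs
      obtain ⟨hmem, hr⟩ := ih (by omega)
      have hmem' : ray 1 x i (s + 1) ∈ encClosure m B := by
        by_contra hc
        exact notMem_encClosure_of_near (hlt s (by omega)) (hpath s) hc hmem
      exact ⟨hmem', hr.tail ⟨hpath s, hmem, hmem'⟩⟩
  refine (hreach _ le_rfl).2.trans (Relation.ReflTransGen.mono ?_ _ _
    (isConn_iff.1 hB _ (Nat.find_spec hex) b hb))
  exact fun u v h => ⟨h.1, subset_encClosure m B h.2.1, subset_encClosure m B h.2.2⟩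

theorem encClosure_mem_simpleSets (hd : 2 ≤ d) {m : ℕ} (hm : 1 ≤ m) {B : Set (Lattice d)}
    (hB : IsConn m B) (hfin : B.Finite) (h0 : (0 : Lattice d) ∈ B) :
    encClosure m B ∈ simpleSets d m :=
  ⟨⟨isConn_encClosure hm (by omega) hB h0, isConn_compl_encClosure hm hd hfin⟩,
    encClosure_finite hm hfin, subset_encClosure m B h0⟩

theorem IsConn.mono {m n : ℕ} (hmn : m ≤ n) {A : Set (Lattice d)} (hA : IsConn m A) :
    IsConn n A := fun x hx y hy => by
  obtain ⟨p, hp, h⟩ := hA x hx y hy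
  exact ⟨p, fun t => (hp t).mono hmn, h⟩

/-! ### Contours of configurations. -/

theorem mem_nonPlusCluster_of_near {ω : Config d} (h0 : ω 0 ≠ 1) {x y : Lattice d}
    (hx : x ∈ nonPlusCluster ω) (hxy : Near 1 x y) (hy : ω y ≠ 1) : y ∈ nonPlusCluster ω := by
  obtain ⟨hconn, hzero, hne⟩ := (isGreatest_nonPlusCluster ω h0).1
  refine Set.mem_sUnion.2 ⟨insert y (nonPlusCluster ω), ⟨?_, Or.inr hzero, ?_⟩, Or.inl rfl⟩
  · refine isConn_of_base x ?_
    rintro z (rfl | hz)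
    · exact .single ⟨hxy.symm, Or.inl rfl, Or.inr hx⟩
    · exact Relation.ReflTransGen.mono (fun u v h => ⟨h.1, Or.inr h.2.1, Or.inr h.2.2⟩) _ _
        (isConn_iff.1 hconn z hz x hx)
  · rintro z (rfl | hz)
    · exact hy
    · exact hne z hz

theorem hamiltonian_zero_eq_top {lam : ℝ} {Λ : Finset (Lattice d)} {ω : Config d}
    {x y : Lattice d} (hx : x ∈ Λ) (hxy : Neighbor x y) (hω : ω x * ω y = -1) :
    hamiltonian (fun _ => 0) lam Λ ω = ⊤ := by
  classical
  have h : (∑ x ∈ Λ, ∑' y : Lattice d,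
      (if Neighbor x y ∧ ω x * ω y = -1 then (1 : ℝ≥0∞) else 0)) ≠ 0 := by
    intro h
    have h1 := ENNReal.tsum_eq_zero.1 (Finset.sum_eq_zero_iff.1 h x hx) y
    simp [hxy, hω] at h1
  unfold hamiltonian
  rw [ENNReal.top_mul h, EReal.coe_ennreal_top, EReal.coe_add_top, EReal.top_sub_coe]

theorem mul_ne_neg_one_of_mem_plusConfigs {lam : ℝ} {Λ : Finset (Lattice d)} {ω : Config d}
    (hω : ω ∈ plusConfigs lam Λ) {x y : Lattice d} (hx : x ∈ Λ) (hxy : Neighbor x y) :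
    ω x * ω y ≠ -1 := fun h => hω.2.ne (hamiltonian_zero_eq_top hx hxy h)

theorem contourSet_mem_simpleSets (hd : 2 ≤ d) {lam : ℝ} {Λ : Finset (Lattice d)} {ω : Config d}
    (hω : ω ∈ plusConfigs lam Λ) (h0 : ω 0 ≠ 1) :
    contourSet ω ∈ simpleSets d 2 ∧ ∀ x ∈ innerBoundary 1 (contourSet ω), ω x = 0 := by
  obtain ⟨hconn, hzero, hne⟩ := (isGreatest_nonPlusCluster ω h0).1
  have hsub : ∀ x ∈ nonPlusCluster ω, x ∈ Λ := fun x hx => by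
    by_contra hc
    exact hne x hx (hω.1 x hc)
  rw [contourSet, if_neg h0]
  refine ⟨encClosure_mem_simpleSets hd one_le_two (hconn.mono one_le_two)
    (Λ.finite_toSet.subset hsub) hzero, ?_⟩
  rintro x ⟨hx, y, hy, hxy⟩
  have hxB : x ∈ nonPlusCluster ω :=
    innerBoundary_encClosure_subset 2 _ ⟨hx, y, hy, hxy.mono one_le_two⟩
  -- Otherwise maximality of the cluster would absorb `y`.
  have hyω : ω y = 1 := by
    by_contra hc
    exact hy (subset_encClosure 2 _ (mem_nonPlusCluster_of_near h0 hxB hxy hc))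
  have hnb : Neighbor x y := by
    have h1 : l1Dist x y ≠ 0 := fun h => hy (l1Dist_eq_zero.1 h ▸ hx)
    have h2 := l1Dist_nonneg x y
    have h3 : l1Dist x y ≤ 1 := by exact_mod_cast hxy
    unfold Neighbor
    omega
  have hmul := mul_ne_neg_one_of_mem_plusConfigs hω (hsub x hxB) hnb
  rw [hyω, mul_one] at hmul
  have hx1 := hne x hxB
  revert hmul hx1
  generalize ω x = s
  revert s
  decide

end WidomRowlinson

theorem mainTheorem5 (d : ℕ) (hd : 2 ≤ d) :
    (∀ (lam : ℝ) (Λ : Finset (WidomRowlinson.Lattice d)),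
      (Λ : Set (WidomRowlinson.Lattice d)) ∈ WidomRowlinson.simpleSets d 2 →
      ∀ ω ∈ WidomRowlinson.plusConfigs lam Λ, ω 0 ≠ 1 →
        WidomRowlinson.contourSet ω ∈ WidomRowlinson.simpleSets d 2 ∧
        ∀ x ∈ WidomRowlinson.innerBoundary 1 (WidomRowlinson.contourSet ω), ω x = 0) ∧
    ∃ C : ℝ, 0 < C ∧ ∀ n : ℕ,
      {A | A ∈ WidomRowlinson.simpleSets d 2 ∧
        (WidomRowlinson.innerBoundary 2 A).encard = (n : ℕ∞)}.Finite ∧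
      (({A | A ∈ WidomRowlinson.simpleSets d 2 ∧
        (WidomRowlinson.innerBoundary 2 A).encard = (n : ℕ∞)}.ncard : ℕ) : ℝ) ≤ C ^ n := by
  exact ⟨fun _ _ _ _ hω h0 => WidomRowlinson.contourSet_mem_simpleSets hd hω h0,
    WidomRowlinson.exists_count_bound hd⟩
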